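/- Let $\Omega\subset\mathbb{R}^d$, $d\ge 1$, be a bounded open set, $T>0$ and $\gamma<0$. Let $u_0\in L_2(\Omega)$, $u_0\neq 0$, and let $f(\cdot,t)\in L_2(\Omega)$ for $t\in\,]0,T[$. Let $C_2$ be a constant in the Poincaré inequality, i.e. $C_2\int_\Omega w^2\,dx\le\int_\Omega|\nabla w|^2\,dx$ for all $w\in H_0^1(\Omega)$ (for instance the best one). Write $[h]_+=\max(h,0)$, with the convention that, for $h\le 0$, $[h]_+^{r}=0$ if $r\ne0$ (also if $r<0$) and $[h]_+^0=1$. A weak solution of $$u_t-\Big(\int_\Omega u^2\,dx\Big)^{\gamma}\Delta u=f\ \text{ in }\Omega\times]0,T],\qquad u=0\ \text{ on }\partial\Omega\times]0,T],\qquad u(\cdot,0)=u_0,$$ is a function $u\in L_2(0,T;H_0^1(\Omega))$ with $u_t\in L_2(0,T;L_2(\Omega))$ (so that $u$ has a representative in $C([0,T];L_2(\Omega))$, which is the one used) such that $u(\cdot,0)=u_0$ and, for almost every $t\in\,]0,T[$ and all $w\in H_0^1(\Omega)$, $$\int_\Omega u_t w\,dx+\Big(\int_\Omega u^2\,dx\Big)^{\gamma}\int_\Omega\nabla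 u\cdot\nabla w\,dx=\int_\Omega f w\,dx,$$ where the second term is read as $0$ at times at which $u(\cdot,t)=0$. Suppose that $$A<C_2\Big(\int_\Omega u_0^2\,dx\Big)^{\frac{2\gamma+1}{2}},\qquad B=\frac{2\gamma A}{\big(\int_\Omega u_0^2\,dx\big)^{1/2}}-2\gamma C_2\Big(\int_\Omega u_0^2\,dx\Big)^{\gamma},$$ and that, for almost every $t\in\,]0,T[$, $$\|f(\cdot,t)\|_{L_2(\Omega)}\le A\,[1-Bt]_+^{-\frac{2\gamma+1}{2\gamma}}.$$ Then every weak solution $u$ satisfies, for all $t\in[0,T]$, $$\int_\Omega u^2(x,t)\,dx\le\int_\Omega u_0^2\,dx\;[1-Bt]_+^{\frac1{|\gamma|}}.$$ Moreover $B>0$; consequently $u(\cdot,t)=0$ for all $t\in[0,T]$ with $t\ge 1/B$. -/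

import Mathlib

open MeasureTheory Set
open scoped ContDiff

namespace NonlocalHeat

/-- The space `L₂(Ω)` of real square integrable functions on `Ω ⊆ ℝᵈ`. -/
abbrev L2 {d : ℕ} (Ω : Set (EuclideanSpace ℝ (Fin d))) : Type :=
  Lp ℝ 2 (volume.restrict Ω)

/-- The space `L₂(Ω; ℝᵈ)` of square integrable vector fields on `Ω`. -/
abbrev L2Vec {d : ℕ} (Ω : Set (EuclideanSpace ℝ (Fin d))) : Type :=
  Lp (EuclideanSpace ℝ (Fin d)) 2 (volume.restrict Ω)

/-- Test functions: smooth functions with compact support contained in `Ω`. -/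
structure IsTestFunction {d : ℕ} (Ω : Set (EuclideanSpace ℝ (Fin d)))
    (φ : EuclideanSpace ℝ (Fin d) → ℝ) : Prop where
  contDiff : ContDiff ℝ ∞ φ
  hasCompactSupport : HasCompactSupport φ
  tsupport_subset : tsupport φ ⊆ Ω

/-- The pairs `(φ, ∇φ)` with `φ ∈ C_c^∞(Ω)`, inside `L₂(Ω) × L₂(Ω; ℝᵈ)`, which carries the norm
`(‖v‖² + ‖G‖²)^(1/2)`, that is, the `H¹` norm on pairs `(v, ∇v)`. -/
def testGraph {d : ℕ} (Ω : Set (EuclideanSpace ℝ (Fin d))) :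
    Submodule ℝ (WithLp 2 (L2 Ω × L2Vec Ω)) where
  carrier := {p | ∃ φ : EuclideanSpace ℝ (Fin d) → ℝ, IsTestFunction Ω φ ∧
    (p.fst =ᵐ[volume.restrict Ω] φ) ∧ (p.snd =ᵐ[volume.restrict Ω] gradient φ)}
  zero_mem' := by
    refine ⟨fun _ => 0, ⟨contDiff_const, HasCompactSupport.zero, ?_⟩, ?_, ?_⟩
    · have h : tsupport (fun _ : EuclideanSpace ℝ (Fin d) => (0 : ℝ)) = ∅ :=
        tsupport_eq_empty_iff.2 rfl
      rw [h]
      exact empty_subset Ω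
    · exact Lp.coeFn_zero ℝ 2 (volume.restrict Ω)
    · filter_upwards [Lp.coeFn_zero (EuclideanSpace ℝ (Fin d)) 2 (volume.restrict Ω)] with x hx
      have h : gradient (fun _ : EuclideanSpace ℝ (Fin d) => (0 : ℝ)) x = 0 := by
        simp [gradient]
      rw [h]
      exact hx
  add_mem' := by
    rintro p q ⟨φ, hφ, h1, h2⟩ ⟨ψ, hψ, h3, h4⟩
    refine ⟨φ + ψ, ⟨hφ.contDiff.add hψ.contDiff,
      hφ.hasCompactSupport.add hψ.hasCompactSupport,
      (tsupport_add φ ψ).trans (union_subset hφ.tsupport_subset hψ.tsupport_subset)⟩, ?_, ?_⟩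
    · exact (Lp.coeFn_add p.fst q.fst).trans (h1.add h3)
    · filter_upwards [Lp.coeFn_add p.snd q.snd, h2, h4] with x hx hx2 hx4
      have hd1 : DifferentiableAt ℝ φ x := hφ.contDiff.differentiable (by simp) x
      have hd2 : DifferentiableAt ℝ ψ x := hψ.contDiff.differentiable (by simp) x
      have h : gradient (φ + ψ) x = gradient φ x + gradient ψ x := by
        simp only [gradient, fderiv_add hd1 hd2, map_add]
      rw [h, ← hx2, ← hx4]
      exact hx
  smul_mem' := by
    rintro c p ⟨φ, hφ, h1, h2⟩
    have hs : tsupport (c • φ) ⊆ tsupport φ :=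
      closure_mono (Function.support_const_smul_subset c φ)
    refine ⟨c • φ, ⟨contDiff_const.smul hφ.contDiff,
      hφ.hasCompactSupport.mono' ((subset_tsupport _).trans hs),
      hs.trans hφ.tsupport_subset⟩, ?_, ?_⟩
    · exact (Lp.coeFn_smul c p.fst).trans (h1.const_smul c)
    · filter_upwards [Lp.coeFn_smul c p.snd, h2] with x hx hx2
      have hd1 : DifferentiableAt ℝ φ x := hφ.contDiff.differentiable (by simp) x
      have h : gradient (c • φ) x = c • gradient φ x := by
        simp only [gradient, fderiv_const_smul hd1, map_smul]
      rw [h, ← hx2]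
      exact hx

/-- The Sobolev space `H₀¹(Ω)`: the closure of `C_c^∞(Ω)` in the `H¹` norm. An element is a pair
`(v, ∇v)` of a function and its weak gradient. -/
noncomputable abbrev H01 {d : ℕ} (Ω : Set (EuclideanSpace ℝ (Fin d))) :
    Submodule ℝ (WithLp 2 (L2 Ω × L2Vec Ω)) :=
  (testGraph Ω).topologicalClosure

/-- The function underlying an element of `H₀¹(Ω)`. -/
noncomputable def H01.fn {d : ℕ} {Ω : Set (EuclideanSpace ℝ (Fin d))} (w : H01 Ω) : L2 Ω :=
  (w : WithLp 2 (L2 Ω × L2Vec Ω)).fst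

/-- The weak gradient of an element of `H₀¹(Ω)`. -/
noncomputable def H01.grad {d : ℕ} {Ω : Set (EuclideanSpace ℝ (Fin d))} (w : H01 Ω) : L2Vec Ω :=
  (w : WithLp 2 (L2 Ω × L2Vec Ω)).snd

/-- `∫_Ω v² dx`. -/
noncomputable def energy {d : ℕ} {Ω : Set (EuclideanSpace ℝ (Fin d))} (v : L2 Ω) : ℝ :=
  ∫ x in Ω, (v x) ^ 2

/-- `C` is a constant in the Poincaré inequality `C ∫_Ω w² ≤ ∫_Ω |∇w|²` on `H₀¹(Ω)`. -/
def IsPoincareConstant {d : ℕ} (Ω : Set (EuclideanSpace ℝ (Fin d))) (C : ℝ) : Prop :=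
  ∀ w : H01 Ω, C * energy (H01.fn w) ≤ ∫ x in Ω, ‖H01.grad w x‖ ^ 2

/-- `v` is the weak derivative on `]0,T[` of the curve `u` in `L₂(Ω)`:
`∫₀ᵀ φ' u dt = - ∫₀ᵀ φ v dt` for all `φ ∈ C_c^∞(]0,T[)`. -/
def HasWeakTimeDeriv {d : ℕ} {Ω : Set (EuclideanSpace ℝ (Fin d))} (T : ℝ)
    (u v : ℝ → L2 Ω) : Prop :=
  ∀ φ : ℝ → ℝ, ContDiff ℝ ∞ φ → HasCompactSupport φ → tsupport φ ⊆ Ioo 0 T →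
    ∫ t in Ioo 0 T, deriv φ t • u t = - ∫ t in Ioo 0 T, φ t • v t

/-- Weak solutions on `Ω × ]0,T]` of `u_t - (∫_Ω u² dx)^γ Δu = f`, `u = 0` on `∂Ω`, `u(0) = u₀`:
`u ∈ L₂(0,T;H₀¹(Ω))`, `u_t ∈ L₂(0,T;L₂(Ω))`, and for almost every `t`
`∫ u_t w dx + (∫ u² dx)^γ ∫ ∇u · ∇w dx = ∫ f w dx` for all `w ∈ H₀¹(Ω)`.
Here `u` is taken to be the representative that is continuous on `[0,T]` with values in `L₂(Ω)`;
it gives a meaning to `u(0) = u₀` and to `u(t)` for every `t`. At a time where `u(t) = 0` and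
`γ < 0`, also `∇u(t) = 0`, and the diffusion term is read as `0`. -/
structure IsWeakSolution {d : ℕ} (Ω : Set (EuclideanSpace ℝ (Fin d))) (T γ : ℝ)
    (f : ℝ → L2 Ω) (u₀ : L2 Ω) (u : ℝ → L2 Ω) : Prop where
  continuousOn : ContinuousOn u (Icc 0 T)
  initial : u 0 = u₀
  weak : ∃ (U : ℝ → H01 Ω) (u' : ℝ → L2 Ω),
    MemLp U 2 (volume.restrict (Ioo 0 T)) ∧
    (∀ᵐ t ∂(volume.restrict (Ioo 0 T)), u t = H01.fn (U t)) ∧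
    MemLp u' 2 (volume.restrict (Ioo 0 T)) ∧
    HasWeakTimeDeriv T u u' ∧
    ∀ᵐ t ∂(volume.restrict (Ioo 0 T)), ∀ w : H01 Ω,
      (∫ x in Ω, u' t x * H01.fn w x)
        + energy (u t) ^ γ * (∫ x in Ω, inner ℝ (H01.grad (U t) x) (H01.grad w x))
        = ∫ x in Ω, f t x * H01.fn w x

/-- The power `[h]₊ ^ r` of the positive part. For `h ≤ 0` its value is `0` if `r ≠ 0`
(also for `r < 0`) and `1` if `r = 0`. -/
noncomputable def posPow (h r : ℝ) : ℝ := (max h 0) ^ r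

end NonlocalHeat

/-! Testing the equation with `u` itself, and using Poincaré and Cauchy–Schwarz, gives for `E = ∫
u²` the inequality `E' ≤ 2 (-C₂ E^(γ+1) + A [1 - B t]₊^r E^(1/2))`, `r = -(2γ+1)/(2γ)`. The number
`B` is chosen so that `y = E(0) (1 - B t)^(1/|γ|)` satisfies it with equality before `1/B`.

To compare, put `q = E / y`. Where `q > 1`, `√q ≤ q` makes the source cancel against the
contribution of `y'`, and `1 - q^γ ≤ |γ| (q - 1)` leaves `(q - 1)' ≤ K (q - 1)` on each `[0, b]`
with `b < 1/B`; Gronwall gives `q ≤ 1`. Continuity yields `E(1/B) = 0`, and afterwards `E' ≤ 0`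
wherever `E > 0`, so `E` stays zero.

The chain rule for `E` needs a du Bois-Reymond argument: the continuous representative `u` is the
integral of its weak derivative, so `‖u‖²` is absolutely continuous. -/

/-! ### Absolute continuity and comparison. -/

/-- If an absolutely continuous function grows at most exponentially wherever it is positive and is
nonpositive initially, then it stays nonpositive. -/
theorem AbsolutelyContinuousOnInterval.nonpos_of_deriv_le_mul_self {g : ℝ → ℝ} {a b K : ℝ}
    (hab : a ≤ b) (hg : AbsolutelyContinuousOnInterval g a b) (ha : g a ≤ 0)
    (hd : ∀ᵐ t, t ∈ Ioo a b → 0 < g t → deriv g t ≤ K * g t) : g b ≤ 0 := by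
  by_contra! hb
  have hc := hg.continuousOn
  rw [uIcc_of_le hab] at hc
  have hS : IsClosed (Icc a b ∩ g ⁻¹' Iic 0) := hc.preimage_isClosed_of_isClosed isClosed_Icc isClosed_Iic
  have hne : (Icc a b ∩ g ⁻¹' Iic 0).Nonempty := ⟨a, ⟨le_rfl, hab⟩, ha⟩
  have hbdd : BddAbove (Icc a b ∩ g ⁻¹' Iic 0) := ⟨b, fun x hx => hx.1.2⟩
  -- After the last time `c` with `g ≤ 0` the differential inequality holds almost everywhere, so
  -- `exp (-K t) g t` cannot increase from `c` to `b`.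
  obtain ⟨⟨hac, hcb⟩, hgc⟩ := hS.csSup_mem hne hbdd
  set c := sSup (Icc a b ∩ g ⁻¹' Iic 0) with hcdef
  have hpos : ∀ t ∈ Ioc c b, 0 < g t := by
    intro t ht
    by_contra! h
    exact absurd (le_csSup hbdd ⟨⟨hac.trans ht.1.le, ht.2⟩, h⟩) (not_le.2 ht.1)
  have hgcb : AbsolutelyContinuousOnInterval g c b := hg.mono (by
    rw [uIcc_of_le hcb, uIcc_of_le hab]; exact Icc_subset_Icc_left hac)
  have he : AbsolutelyContinuousOnInterval (fun t => Real.exp (-K * t)) c b :=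
    ContDiffOn.absolutelyContinuousOnInterval (by fun_prop)
  have h1 := (he.fun_mul hgcb).integral_deriv_eq_sub
  have h2 : ∫ t in c..b, deriv (fun t => Real.exp (-K * t) * g t) t ≤ 0 := by
    rw [intervalIntegral.integral_of_le hcb, integral_Ioc_eq_integral_Ioo]
    refine integral_nonpos_of_ae ?_
    filter_upwards [ae_restrict_of_ae hd, ae_restrict_mem measurableSet_Ioo,
      ae_restrict_of_ae hg.ae_differentiableAt] with t ht htm htd
    have htab : t ∈ Ioo a b := ⟨hac.trans_lt htm.1, htm.2⟩
    have hgt := hpos t ⟨htm.1, htm.2.le⟩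
    have hda : HasDerivAt g (deriv g t) t :=
      (htd (by rw [uIcc_of_le hab]; exact Ioo_subset_Icc_self htab)).hasDerivAt
    have hde : HasDerivAt (fun t => Real.exp (-K * t)) (Real.exp (-K * t) * (-K * 1)) t :=
      ((hasDerivAt_id t).const_mul (-K)).exp
    rw [(hde.fun_mul hda).deriv]
    have := mul_le_mul_of_nonneg_left (ht htab hgt) (Real.exp_pos (-K * t)).le
    simp only [Pi.zero_apply]
    linarith
  have h3 : 0 < Real.exp (-K * b) * g b := mul_pos (Real.exp_pos _) hb
  have h4 : Real.exp (-K * c) * g c ≤ 0 :=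
    mul_nonpos_of_nonneg_of_nonpos (Real.exp_pos _).le hgc
  linarith

/-- A function whose increments are dominated by those of an absolutely continuous function is
absolutely continuous. -/
theorem AbsolutelyContinuousOnInterval.of_dist_le {X Y : Type*} [PseudoMetricSpace X]
    [PseudoMetricSpace Y] {f : ℝ → X} {g : ℝ → Y} {a b C : ℝ}
    (hg : AbsolutelyContinuousOnInterval g a b)
    (h : ∀ s ∈ uIcc a b, ∀ t ∈ uIcc a b, dist (f s) (f t) ≤ C * dist (g s) (g t)) :
    AbsolutelyContinuousOnInterval f a b := by
  unfold AbsolutelyContinuousOnInterval at hg ⊢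
  refine squeeze_zero' (Filter.Eventually.of_forall fun E => Finset.sum_nonneg fun _ _ => dist_nonneg)
    ?_ (by simpa using hg.const_mul C)
  filter_upwards [Filter.mem_inf_of_right (Filter.mem_principal_self _)] with E hE
  rw [Finset.mul_sum]
  exact Finset.sum_le_sum fun i hi => h _ (hE.1 i hi).1 _ (hE.1 i hi).2

/-! ### Weak time derivatives of Hilbert-valued curves. -/

/-- A compact subset of an open interval lies in a closed subinterval. -/
theorem IsCompact.exists_subset_Icc_of_subset_Ioo {s : Set ℝ} {a b : ℝ} (hs : IsCompact s)
    (hab : a < b) (h : s ⊆ Ioo a b) : ∃ c d, a < c ∧ d < b ∧ s ⊆ Icc c d := by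
  rcases s.eq_empty_or_nonempty with rfl | hne
  · exact ⟨(a + b) / 2, (a + b) / 2, by linarith, by linarith, empty_subset _⟩
  · exact ⟨sInf s, sSup s, (h (hs.sInf_mem hne)).1, (h (hs.sSup_mem hne)).2,
      fun x hx => ⟨csInf_le hs.bddBelow hx, le_csSup hs.bddAbove hx⟩⟩

/-- A test function on an interval with integral zero is the derivative of a test function. -/
theorem exists_contDiff_deriv_eq_of_integral_eq_zero {η : ℝ → ℝ} {a b : ℝ} (hab : a < b)
    (hη : ContDiff ℝ ∞ η) (hc : HasCompactSupport η) (hs : tsupport η ⊆ Ioo a b)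
    (h0 : ∫ t, η t = 0) :
    ∃ φ : ℝ → ℝ, ContDiff ℝ ∞ φ ∧ HasCompactSupport φ ∧ tsupport φ ⊆ Ioo a b ∧ deriv φ = η := by
  obtain ⟨c, d, hac, hdb, hcd⟩ := hc.isCompact.exists_subset_Icc_of_subset_Ioo hab hs
  have hz : ∀ t ∉ Icc c d, η t = 0 := fun t ht => image_eq_zero_of_notMem_tsupport fun h => ht (hcd h)
  have hd : ∀ t, HasDerivAt (fun t => ∫ x in a..t, η x) (η t) t := fun t =>
    hη.continuous.integral_hasStrictDerivAt a t |>.hasDerivAt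
  have hderiv : deriv (fun t => ∫ x in a..t, η x) = η := funext fun t => (hd t).deriv
  have hsub : Function.support (fun t => ∫ x in a..t, η x) ⊆ Icc c d := by
    intro t ht
    by_contra hn
    apply ht
    rw [mem_Icc, not_and_or, not_le, not_le] at hn
    rcases hn with hn | hn
    · refine (intervalIntegral.integral_congr (g := fun _ => 0) fun x hx => hz x fun hx' => ?_).trans
        (by simp)
      rw [uIcc, mem_Icc] at hx
      have := hx.2.trans (max_le hac.le hn.le)
      rcases le_total a t with h | h
      · rw [max_eq_right h] at hx; linarith [hx.2, hx'.1]
      · rw [max_eq_left h] at hx; linarith [hx.2, hx'.1]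
    · rw [← h0]
      dsimp only
      rcases le_or_gt a t with hat | hat
      · rw [intervalIntegral.integral_of_le hat]
        refine setIntegral_eq_integral_of_forall_compl_eq_zero fun x hx => hz x fun hx' => hx ?_
        exact ⟨hac.trans_le hx'.1, hx'.2.trans hn.le⟩
      -- Here `d < t < a < c`, so `[c, d]` is empty.
      · have : η = 0 := funext fun x => hz x fun hx' => by linarith [hx'.1, hx'.2]
        simp [this]
  have hts : tsupport (fun t => ∫ x in a..t, η x) ⊆ Icc c d := closure_minimal hsub isClosed_Icc
  refine ⟨_, ?_, HasCompactSupport.of_support_subset_isCompact isCompact_Icc hsub,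
    hts.trans (Icc_subset_Ioo hac hdb), hderiv⟩
  rw [contDiff_infty_iff_deriv, hderiv]
  exact ⟨fun t => (hd t).differentiableAt, hη⟩

/-- The du Bois-Reymond lemma for continuous functions. -/
theorem ContinuousOn.eq_of_integral_deriv_mul_eq_zero {g : ℝ → ℝ} {a b : ℝ} (hab : a < b)
    (hg : ContinuousOn g (Icc a b))
    (h : ∀ φ : ℝ → ℝ, ContDiff ℝ ∞ φ → HasCompactSupport φ → tsupport φ ⊆ Ioo a b →
      ∫ t in Ioo a b, deriv φ t * g t = 0) :
    ∀ t ∈ Icc a b, g t = g a := by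
  obtain ⟨ψ₀, hs₀, hc₀, hd₀, hr₀, hp₀⟩ : ∃ ψ : ℝ → ℝ, tsupport ψ ⊆ Ioo a b ∧
      HasCompactSupport ψ ∧ ContDiff ℝ ∞ ψ ∧ range ψ ⊆ Icc 0 1 ∧ ψ ((a + b) / 2) = 1 :=
    exists_contDiff_tsupport_subset (Ioo_mem_nhds (by linarith) (by linarith))
  have hI₀ : 0 < ∫ t, ψ₀ t := by
    refine hd₀.continuous.integral_pos_of_hasCompactSupport_nonneg_nonzero hc₀
      (fun x => (hr₀ ⟨x, rfl⟩).1) (x := (a + b) / 2) (by simp [hp₀])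
  have hint : ∀ ψ : ℝ → ℝ, Continuous ψ → IntegrableOn (fun t => ψ t * g t) (Ioo a b) :=
    fun ψ hψ => ((hψ.continuousOn.mul hg).integrableOn_Icc).mono_set Ioo_subset_Icc_self
  have hfull : ∀ ψ : ℝ → ℝ, tsupport ψ ⊆ Ioo a b → ∀ k : ℝ → ℝ,
      ∫ t in Ioo a b, ψ t * k t = ∫ t, ψ t * k t := fun ψ hψ k =>
    setIntegral_eq_integral_of_forall_compl_eq_zero fun x hx => by
      rw [image_eq_zero_of_notMem_tsupport fun h => hx (hψ h), zero_mul]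
  -- The `ψ₀`-weighted mean is the only possible constant value of `g`. Subtracting `m ψ₀` from any
  -- test function `ψ` makes its integral vanish, so the difference is an admissible `deriv φ`.
  set c := (∫ t in Ioo a b, ψ₀ t * g t) / ∫ t, ψ₀ t with hcdef
  have key : ∀ ψ : ℝ → ℝ, ContDiff ℝ ∞ ψ → HasCompactSupport ψ → tsupport ψ ⊆ Ioo a b →
      ∫ t, ψ t • (g t - c) = 0 := by
    intro ψ hψd hψc hψs
    set m := (∫ t, ψ t) / ∫ t, ψ₀ t with hm
    have hi := hψd.continuous.integrable_of_hasCompactSupport hψc (μ := volume)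
    have hi₀ := hd₀.continuous.integrable_of_hasCompactSupport hc₀ (μ := volume)
    have hsm : tsupport (fun t => m * ψ₀ t) ⊆ tsupport ψ₀ :=
      closure_mono (Function.support_const_smul_subset m ψ₀)
    obtain ⟨φ, hφd, hφc, hφs, hφ⟩ := exists_contDiff_deriv_eq_of_integral_eq_zero hab
      (η := ψ - fun t => m * ψ₀ t) (hψd.sub (contDiff_const.mul hd₀))
      (hψc.sub (hc₀.mul_left (f := fun _ => m)))
      ((tsupport_sub _ _).trans (union_subset hψs (hsm.trans hs₀))) (by
        simp only [Pi.sub_apply]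
        rw [integral_sub hi (hi₀.const_mul m), integral_const_mul, hm]
        field_simp
        ring)
    have h1 := h φ hφd hφc hφs
    have h2 : ∀ t, deriv φ t * g t = ψ t * g t - m * (ψ₀ t * g t) := fun t => by
      rw [hφ, Pi.sub_apply]; ring
    simp only [h2] at h1
    rw [integral_sub (hint ψ hψd.continuous) ((hint ψ₀ hd₀.continuous).const_mul m),
      integral_const_mul] at h1
    simp only [smul_eq_mul]
    rw [← hfull ψ hψs (fun t => g t - c)]
    have h3 : ∀ t, ψ t * (g t - c) = ψ t * g t - ψ t * c := fun t => by ring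
    simp only [h3]
    rw [integral_sub (hint ψ hψd.continuous) (hi.integrableOn.mul_const c), hfull ψ hψs fun _ => c,
      integral_mul_const, hcdef]
    rw [hm] at h1
    field_simp at h1 ⊢
    linarith
  have hae := isOpen_Ioo.ae_eq_zero_of_integral_contDiff_smul_eq_zero (μ := volume)
    (((hg.sub continuousOn_const).mono Ioo_subset_Icc_self).locallyIntegrableOn
      measurableSet_Ioo) key
  have heq : EqOn g (fun _ => c) (Icc a b) := by
    refine Measure.eqOn_Icc_of_ae_eq (μ := volume) hab.ne ?_ hg continuousOn_const
    rw [Filter.EventuallyEq, ← restrict_Ioo_eq_restrict_Icc, ae_restrict_iff' measurableSet_Ioo]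
    filter_upwards [hae] with t ht htm using sub_eq_zero.1 (ht htm)
  intro t ht
  rw [heq ht, heq (left_mem_Icc.2 hab.le)]

/-- A continuous curve in a Hilbert space with an integrable weak derivative is the integral of this
derivative. -/
theorem eq_add_integral_of_weak_deriv {H : Type*} [NormedAddCommGroup H] [InnerProductSpace ℝ H]
    [CompleteSpace H] {u v : ℝ → H} {a b : ℝ} (hab : a < b) (hu : ContinuousOn u (Icc a b))
    (hv : IntegrableOn v (Ioo a b))
    (h : ∀ φ : ℝ → ℝ, ContDiff ℝ ∞ φ → HasCompactSupport φ → tsupport φ ⊆ Ioo a b →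
      ∫ t in Ioo a b, deriv φ t • u t = - ∫ t in Ioo a b, φ t • v t) :
    ∀ t ∈ Icc a b, u t = u a + ∫ x in a..t, v x := by
  have hvi : IntervalIntegrable v volume a b :=
    (intervalIntegrable_iff_integrableOn_Ioo_of_le hab.le).2 hv
  intro t ht
  -- Pairing with a fixed `e` reduces to the scalar du Bois-Reymond lemma, applied to `⟪e, u⟫` minus
  -- the primitive of `⟪e, v⟫`.
  refine ext_inner_left ℝ fun e => ?_
  have hei : IntervalIntegrable (fun x => inner ℝ e (v x)) volume a b :=
    (intervalIntegrable_iff_integrableOn_Ioo_of_le hab.le).2 (hv.const_inner e)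
  have hAC := hei.absolutelyContinuousOnInterval_intervalIntegral (c := a) (by simp)
  have hPc := hAC.continuousOn
  rw [uIcc_of_le hab.le] at hPc
  have huc : ContinuousOn (fun x => inner ℝ e (u x)) (Icc a b) := continuousOn_const.inner hu
  have := (huc.sub hPc).eq_of_integral_deriv_mul_eq_zero hab (by
    intro φ hφd hφc hφs
    have hφ' : Continuous (deriv φ) := hφd.continuous_deriv (by simp)
    have hz : ∀ x ∉ Ioo a b, φ x = 0 := fun x hx =>
      image_eq_zero_of_notMem_tsupport fun h => hx (hφs h)
    have hφAC : AbsolutelyContinuousOnInterval φ a b :=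
      (hφd.of_le (by simp)).contDiffOn.absolutelyContinuousOnInterval
    have hparts := hφAC.integral_mul_deriv_eq_deriv_mul hAC
    rw [hz a (by simp), hz b (by simp)] at hparts
    have hder : ∫ x in a..b, φ x * deriv (fun x => ∫ y in a..x, inner ℝ e (v y)) x
        = ∫ x in a..b, φ x * inner ℝ e (v x) := by
      refine intervalIntegral.integral_congr_ae ?_
      filter_upwards [hei.ae_hasDerivAt_integral] with x hx hxm
      rw [(hx (uIoc_subset_uIcc hxm) a (by simp)).deriv]
    rw [hder, zero_mul, zero_mul, sub_zero, zero_sub] at hparts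
    have h1 := congrArg (fun z => inner ℝ e z) (h φ hφd hφc hφs)
    have hiu : IntegrableOn (fun x => deriv φ x • u x) (Ioo a b) :=
      ((hφ'.continuousOn.smul hu).integrableOn_Icc).mono_set Ioo_subset_Icc_self
    have hiv : IntegrableOn (fun x => φ x • v x) (Ioo a b) := by
      have := hvi.continuousOn_smul (hφd.continuous.continuousOn (s := uIcc a b))
      exact (intervalIntegrable_iff_integrableOn_Ioo_of_le hab.le).1 this
    simp only [inner_neg_right] at h1
    rw [← integral_inner hiu, ← integral_inner hiv] at h1
    simp only [inner_smul_right] at h1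
    simp only [mul_sub, Pi.sub_apply]
    have hiφ : ∀ k : ℝ → ℝ, ContinuousOn k (Icc a b) →
        IntegrableOn (fun x => deriv φ x * k x) (Ioo a b) := fun k hk =>
      (hφ'.continuousOn.mul hk).integrableOn_Icc.mono_set Ioo_subset_Icc_self
    rw [integral_sub (hiφ _ huc) (hiφ _ hPc), h1]
    rw [intervalIntegral.integral_of_le hab.le, intervalIntegral.integral_of_le hab.le,
      integral_Ioc_eq_integral_Ioo, integral_Ioc_eq_integral_Ioo] at hparts
    linarith) t ht
  simp only [Pi.sub_apply, intervalIntegral.integral_same] at this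
  rw [inner_add_right, intervalIntegral.integral_of_le ht.1, ← integral_inner,
    ← intervalIntegral.integral_of_le ht.1]
  · linarith
  · exact (hvi.1).mono_set (Ioc_subset_Ioc_right ht.2)

/-- The squared norm along the integral of an integrable curve in a Hilbert space is absolutely
continuous, with the expected derivative. -/
theorem absolutelyContinuousOnInterval_norm_sq_of_eq_integral {H : Type*} [NormedAddCommGroup H]
    [InnerProductSpace ℝ H] [CompleteSpace H] {u v : ℝ → H} {a b : ℝ} (hab : a ≤ b)
    (hv : IntegrableOn v (Ioo a b)) (h : ∀ t ∈ Icc a b, u t = u a + ∫ x in a..t, v x) :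
    AbsolutelyContinuousOnInterval (fun t => ‖u t‖ ^ 2) a b ∧
      ∀ᵐ t, t ∈ Ioo a b → HasDerivAt (fun t => ‖u t‖ ^ 2) (2 * inner ℝ (u t) (v t)) t := by
  have hvi : IntervalIntegrable v volume a b :=
    (intervalIntegrable_iff_integrableOn_Ioo_of_le hab).2 hv
  have hsub : ∀ s ∈ Icc a b, ∀ t ∈ Icc a b, IntervalIntegrable v volume s t := fun s hs t ht =>
    hvi.mono_set (by rw [uIcc_of_le hab]; exact uIcc_subset_Icc hs ht)
  have hN := hvi.norm.absolutelyContinuousOnInterval_intervalIntegral (c := a) (by simp)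
  have hl : a ∈ Icc a b := left_mem_Icc.2 hab
  have hdist : ∀ s ∈ Icc a b, ∀ t ∈ Icc a b, dist (u s) (u t)
      ≤ 1 * dist (∫ x in a..s, ‖v x‖) (∫ x in a..t, ‖v x‖) := by
    intro s hs t ht
    rw [h s hs, h t ht, dist_add_left, one_mul, dist_eq_norm, Real.dist_eq,
      intervalIntegral.integral_interval_sub_left (hsub a hl s hs) (hsub a hl t ht),
      intervalIntegral.integral_interval_sub_left (hsub a hl s hs).norm (hsub a hl t ht).norm]
    exact intervalIntegral.norm_integral_le_abs_integral_norm
  have hU : AbsolutelyContinuousOnInterval u a b := hN.of_dist_le (by rwa [uIcc_of_le hab])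
  have hUn : AbsolutelyContinuousOnInterval (fun t => ‖u t‖) a b :=
    hU.of_dist_le (C := 1) fun s _ t _ => by
      rw [one_mul, Real.dist_eq, dist_eq_norm]; exact abs_norm_sub_norm_le _ _
  refine ⟨by simpa only [pow_two] using hUn.fun_mul hUn, ?_⟩
  filter_upwards [hvi.ae_hasDerivAt_integral] with t ht htm
  have h1 := ht (by rw [uIcc_of_le hab]; exact Ioo_subset_Icc_self htm) a (by simp)
  have h2 : HasDerivAt u (v t) t := by
    refine (h1.const_add (u a)).congr_of_eventuallyEq ?_
    filter_upwards [Ioo_mem_nhds htm.1 htm.2] with x hx using h x (Ioo_subset_Icc_self hx)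
  exact h2.norm_sq

/-! ### Comparison of the energy with the explicit profile. -/

open NonlocalHeat in
/-- A positive solution of `E' ≤ 2 (-C E^(γ+1) + A [1 - B t]₊^r E^(1/2))` is dominated by
`E(0) (1 - B t)^(1/|γ|)` up to the time `1 / B`. -/
theorem energy_le_of_deriv_le {E : ℝ → ℝ} {b γ A B C : ℝ} (hb : 0 ≤ b) (hγ : γ < 0)
    (hA : 0 ≤ A) (hC : 0 < C) (hE0 : 0 < E 0) (hB0 : 0 < B) (hB : B = 2 * γ * A / E 0 ^ ((1 : ℝ) / 2) - 2 * γ * C * E 0 ^ γ)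
    (hbB : B * b < 1) (hE : AbsolutelyContinuousOnInterval E 0 b)
    (hd : ∀ᵐ t, t ∈ Ioo 0 b → deriv E t ≤
      2 * (-C * (E t ^ γ * E t) + A * posPow (1 - B * t) (-((2 * γ + 1) / (2 * γ))) * √(E t))) :
    E b ≤ E 0 * (1 - B * b) ^ (1 / |γ|) := by
  set α : ℝ := 1 / |γ| with hα
  have hγ0 : γ ≠ 0 := hγ.ne
  have hαγ : α * γ = -1 := by rw [hα, abs_of_neg hγ]; field_simp
  have hs : ∀ t ∈ Icc 0 b, 1 - B * b ≤ 1 - B * t := fun t ht => by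
    linarith [mul_le_mul_of_nonneg_left ht.2 hB0.le]
  have hs0 : 0 < 1 - B * b := by linarith
  have hsC : ContDiffOn ℝ 1 (fun t => (E 0)⁻¹ * (1 - B * t) ^ (-α)) (uIcc 0 b) := by
    rw [uIcc_of_le hb]
    refine contDiffOn_const.mul (ContDiffOn.rpow_const_of_ne (by fun_prop) fun t ht => ?_)
    exact (hs0.trans_le (hs t ht)).ne'
  have hq := hE.fun_mul hsC.absolutelyContinuousOnInterval
  obtain ⟨Q, hQ⟩ := hq.exists_bound
  have hg := hq.fun_sub (contDiffOn_const (c := (1 : ℝ))).absolutelyContinuousOnInterval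
  have hB' : α * B = 2 * C * E 0 ^ γ - 2 * A / √(E 0) := by
    have : α * B = (α * γ) * (2 * A / √(E 0) - 2 * C * E 0 ^ γ) := by
      rw [hB, Real.sqrt_eq_rpow]; ring
    rw [this, hαγ]; ring
  have key := hg.nonpos_of_deriv_le_mul_self hb
    -- `K` comes from bounding `s⁻¹` by `(1 - B b)⁻¹` and the factor `q` by `Q`; this is where
    -- staying away from `1/B` matters.
    (K := (1 - B * b)⁻¹ * (Q * (2 * C * E 0 ^ γ * -γ))) (by simp [hE0.ne']) (by
    filter_upwards [hd, hE.ae_differentiableAt] with t ht hdt htm hpos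
    have htI : t ∈ Icc 0 b := Ioo_subset_Icc_self htm
    have htu : t ∈ uIcc 0 b := by rwa [uIcc_of_le hb]
    have hst : 0 < 1 - B * t := hs0.trans_le (hs t htI)
    set s := 1 - B * t with hsdef
    set q := E t * ((E 0)⁻¹ * s ^ (-α)) with hqdef
    have hq1 : 1 < q := by linarith
    have hqQ : q ≤ Q := (le_abs_self _).trans (hQ t htu)
    have hEt : E t = E 0 * s ^ α * q := by
      rw [hqdef, Real.rpow_neg hst.le]
      have := (Real.rpow_pos_of_pos hst α).ne'
      field_simp
    have hsd : HasDerivAt (fun t => 1 - B * t) (-B) t := by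
      simpa using ((hasDerivAt_id t).const_mul B).const_sub 1
    have hD : HasDerivAt (fun t => E t * ((E 0)⁻¹ * (1 - B * t) ^ (-α)) - 1)
        (deriv E t * ((E 0)⁻¹ * s ^ (-α)) + E t * ((E 0)⁻¹ * (-B * (-α) * s ^ (-α - 1)))) t :=
      ((hdt htu).hasDerivAt.fun_mul
        ((hsd.rpow_const (Or.inl hst.ne')).const_mul (E 0)⁻¹)).sub_const 1
    rw [hD.deriv]
    have hsα := Real.rpow_pos_of_pos hst α
    have hsnα := Real.rpow_pos_of_pos hst (-α)
    have hcancel : s ^ α * s ^ (-α) = 1 := by rw [← Real.rpow_add hst]; simp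
    have e1 : E t ^ γ = E 0 ^ γ * s⁻¹ * q ^ γ := by
      rw [hEt, Real.mul_rpow (by positivity) (by positivity),
        Real.mul_rpow hE0.le (by positivity), ← Real.rpow_mul hst.le, hαγ, Real.rpow_neg_one]
    have e2 : posPow s (-((2 * γ + 1) / (2 * γ))) = s⁻¹ * √(s ^ α) := by
      rw [posPow, max_eq_left hst.le, Real.sqrt_eq_rpow, ← Real.rpow_mul hst.le,
        ← Real.rpow_neg_one, ← Real.rpow_add hst]
      congr 1
      have : α = -1 / γ := by rw [eq_div_iff hγ0, hαγ]
      rw [this]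
      field_simp
      ring
    -- Uses `√q ≤ q`, valid since `q > 1`.
    have e3 : √(E t) ≤ √(E 0) * √(s ^ α) * q := by
      rw [hEt, Real.sqrt_mul (by positivity), Real.sqrt_mul hE0.le]
      gcongr
      rw [Real.sqrt_le_left (by positivity)]
      nlinarith
    have e4 : √(s ^ α) * √(s ^ α) = s ^ α := Real.mul_self_sqrt hsα.le
    have e5 : √(E 0) * √(E 0) = E 0 := Real.mul_self_sqrt hE0.le
    have hsq := Real.sqrt_pos.2 hE0
    have b1 : deriv E t ≤ 2 * (-C * (E 0 ^ γ * s⁻¹ * q ^ γ * (E 0 * s ^ α * q))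
        + A * (s⁻¹ * √(s ^ α)) * (√(E 0) * √(s ^ α) * q)) := by
      refine (ht htm).trans ?_
      rw [e2, e1, ← hEt]
      gcongr
    have b2 : deriv E t * ((E 0)⁻¹ * s ^ (-α)) ≤
        s⁻¹ * q * (2 * A / √(E 0) - 2 * C * E 0 ^ γ * q ^ γ) := by
      refine (mul_le_mul_of_nonneg_right b1 (by positivity)).trans_eq ?_
      calc _ = s⁻¹ * q * (2 * A * (√(E 0) * (E 0)⁻¹) * ((√(s ^ α) * √(s ^ α)) * s ^ (-α))
              - 2 * C * E 0 ^ γ * q ^ γ * (E 0 * (E 0)⁻¹) * (s ^ α * s ^ (-α))) := by ring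
        _ = _ := by
          rw [e4, hcancel, mul_inv_cancel₀ hE0.ne']
          nth_rewrite 2 [← e5]
          field_simp
    have b3 : E t * ((E 0)⁻¹ * (-B * (-α) * s ^ (-α - 1))) = s⁻¹ * q * (α * B) := by
      rw [hqdef, sub_eq_add_neg, Real.rpow_add hst, Real.rpow_neg_one]; ring
    -- `q^γ = exp (γ log q) ≥ 1 + γ log q ≥ 1 + γ (q - 1)`, the last step because `γ < 0`.
    have hlog : 1 - q ^ γ ≤ -γ * (q - 1) := by
      rw [Real.rpow_def_of_pos (by linarith)]
      have h1 := Real.add_one_le_exp (Real.log q * γ)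
      have h2 := Real.log_le_sub_one_of_pos (show 0 < q by linarith)
      nlinarith
    have hE0γ := Real.rpow_pos_of_pos hE0 γ
    rw [b3, hB']
    calc _ ≤ s⁻¹ * q * (2 * A / √(E 0) - 2 * C * E 0 ^ γ * q ^ γ)
          + s⁻¹ * q * (2 * C * E 0 ^ γ - 2 * A / √(E 0)) := by gcongr
      _ = s⁻¹ * (q * (2 * C * E 0 ^ γ * (1 - q ^ γ))) := by ring
      _ ≤ s⁻¹ * (q * (2 * C * E 0 ^ γ * (-γ * (q - 1)))) := by gcongr
      _ ≤ (1 - B * b)⁻¹ * (Q * (2 * C * E 0 ^ γ * (-γ * (q - 1)))) := by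
          have : 0 ≤ -γ * (q - 1) := mul_nonneg (by linarith) (by linarith)
          have := hs t htI
          gcongr
      _ = _ := by ring)
  have hsα := Real.rpow_pos_of_pos hs0 α
  rw [Real.rpow_neg hs0.le, sub_nonpos, ← mul_inv, ← div_eq_mul_inv,
    div_le_one (by positivity)] at key
  exact key

/-! ### Energy inequality for weak solutions. -/

namespace NonlocalHeat

variable {d : ℕ} {Ω : Set (EuclideanSpace ℝ (Fin d))}

theorem energy_eq_norm_sq (v : L2 Ω) : energy v = ‖v‖ ^ 2 := by
  rw [← real_inner_self_eq_norm_sq, MeasureTheory.L2.inner_def, energy]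
  simp [pow_two]

theorem integral_mul_eq_inner (v w : L2 Ω) : ∫ x in Ω, v x * w x = inner ℝ w v := by
  rw [MeasureTheory.L2.inner_def]
  simp

/-- The energy inequality at a time at which the weak formulation holds. -/
theorem inner_le_of_weak_form {γ C a : ℝ} (hC : IsPoincareConstant Ω C) {f v : L2 Ω} {U : H01 Ω}
    (h : ∀ w : H01 Ω, (∫ x in Ω, v x * H01.fn w x)
        + energy (H01.fn U) ^ γ * (∫ x in Ω, inner ℝ (H01.grad U x) (H01.grad w x))
        = ∫ x in Ω, f x * H01.fn w x) (hf : ‖f‖ ≤ a) :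
    inner ℝ (H01.fn U) v ≤ -C * (energy (H01.fn U) ^ γ * energy (H01.fn U))
      + a * √(energy (H01.fn U)) := by
  have h1 := h U
  have hE : 0 ≤ energy (H01.fn U) := by rw [energy_eq_norm_sq]; positivity
  simp only [integral_mul_eq_inner, real_inner_self_eq_norm_sq] at h1
  have h2 := mul_le_mul_of_nonneg_left (hC U) (Real.rpow_nonneg hE γ)
  have h3 := (real_inner_le_norm (H01.fn U) f).trans
    (mul_le_mul_of_nonneg_left hf (norm_nonneg (H01.fn U)))
  have h4 : √(energy (H01.fn U)) = ‖H01.fn U‖ := by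
    rw [energy_eq_norm_sq, Real.sqrt_sq (norm_nonneg _)]
  rw [h4]
  linarith

/-- The energy of a weak solution is absolutely continuous and satisfies a differential
inequality. -/
theorem IsWeakSolution.energy_deriv_le {T γ C : ℝ} {f : ℝ → L2 Ω} {u₀ : L2 Ω} {u : ℝ → L2 Ω}
    {a : ℝ → ℝ} (hu : IsWeakSolution Ω T γ f u₀ u) (hT : 0 < T) (hC : IsPoincareConstant Ω C)
    (hf : ∀ᵐ t ∂(volume.restrict (Ioo 0 T)), ‖f t‖ ≤ a t) :
    AbsolutelyContinuousOnInterval (fun t => energy (u t)) 0 T ∧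
      ∀ᵐ t, t ∈ Ioo 0 T → deriv (fun t => energy (u t)) t ≤
        2 * (-C * (energy (u t) ^ γ * energy (u t)) + a t * √(energy (u t))) := by
  obtain ⟨U, v, -, hU, hv, hw, hform⟩ := hu.weak
  have hvi : IntegrableOn v (Ioo 0 T) := hv.integrable (by norm_num)
  obtain ⟨h1, h2⟩ := absolutelyContinuousOnInterval_norm_sq_of_eq_integral hT.le hvi
    (eq_add_integral_of_weak_deriv hT hu.continuousOn hvi hw)
  simp only [← energy_eq_norm_sq] at h1 h2
  refine ⟨h1, ?_⟩
  rw [ae_restrict_iff' measurableSet_Ioo] at hU hform hf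
  filter_upwards [h2, hU, hform, hf] with t ht htU htf htb htm
  rw [(ht htm).deriv, htU htm]
  have := inner_le_of_weak_form hC (U := U t) (f := f t) (v := v t) (γ := γ)
    (fun w => by rw [← htU htm]; exact htf htm w) (htb htm)
  linarith

end NonlocalHeat

/-! ### Decay and extinction. -/

theorem mainTheorem7 {d : ℕ} (Ω : Set (EuclideanSpace ℝ (Fin d)))
    (hΩ : IsOpen Ω) (hΩb : Bornology.IsBounded Ω)
    (T γ : ℝ) (hT : 0 < T) (hγ : γ < 0)
    (C₂ : ℝ) (hC₂ : NonlocalHeat.IsPoincareConstant Ω C₂)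
    (f : ℝ → NonlocalHeat.L2 Ω) (u₀ : NonlocalHeat.L2 Ω) (hu₀ : u₀ ≠ 0)
    (A B : ℝ)
    (hA : A < C₂ * NonlocalHeat.energy u₀ ^ ((2 * γ + 1) / 2))
    (hB : B = 2 * γ * A / NonlocalHeat.energy u₀ ^ ((1 : ℝ) / 2)
      - 2 * γ * C₂ * NonlocalHeat.energy u₀ ^ γ)
    (hf : ∀ᵐ t ∂(MeasureTheory.volume.restrict (Set.Ioo 0 T)),
      ‖f t‖ ≤ A * NonlocalHeat.posPow (1 - B * t) (-((2 * γ + 1) / (2 * γ))))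
    (u : ℝ → NonlocalHeat.L2 Ω) (hu : NonlocalHeat.IsWeakSolution Ω T γ f u₀ u) :
    (∀ t ∈ Set.Icc 0 T, NonlocalHeat.energy (u t)
      ≤ NonlocalHeat.energy u₀ * NonlocalHeat.posPow (1 - B * t) (1 / |γ|)) ∧
    0 < B ∧ (∀ t ∈ Set.Icc 0 T, 1 / B ≤ t → u t = 0) := by
  have hE0 : 0 < NonlocalHeat.energy u₀ := by
    rw [NonlocalHeat.energy_eq_norm_sq]; have := norm_pos_iff.2 hu₀; positivity
  have hB0 : 0 < B := by
    have h1 := Real.rpow_pos_of_pos hE0 ((1 : ℝ) / 2)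
    have h2 : NonlocalHeat.energy u₀ ^ ((2 * γ + 1) / 2)
        = NonlocalHeat.energy u₀ ^ γ * NonlocalHeat.energy u₀ ^ ((1 : ℝ) / 2) := by
      rw [← Real.rpow_add hE0]; congr 1; ring
    rw [h2, ← mul_assoc, ← div_lt_iff₀ h1] at hA
    have : B = -2 * γ * (C₂ * NonlocalHeat.energy u₀ ^ γ
        - A / NonlocalHeat.energy u₀ ^ ((1 : ℝ) / 2)) := by rw [hB]; ring
    rw [this]
    exact mul_pos (by linarith) (by linarith)
  -- Before `1/B` the weight is positive and the product dominates a norm, which forces `A ≥ 0`;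
  -- then `hA` forces `C₂ > 0`.
  have hA0 : 0 ≤ A := by
    have hpos : (volume (Ioo 0 (min T (1 / B)))) ≠ 0 := by
      have : 0 < min T (1 / B) := lt_min hT (by positivity)
      simpa using this
    obtain ⟨t, ht, hft⟩ := ((frequently_ae_mem_iff.2 hpos).and_eventually
      ((ae_restrict_iff' measurableSet_Ioo).1 hf)).exists
    have hs : 0 < 1 - B * t := by
      have := (lt_div_iff₀ hB0).1 (ht.2.trans_le (min_le_right _ _)); linarith
    have h := (norm_nonneg _).trans (hft ⟨ht.1, ht.2.trans_le (min_le_left _ _)⟩)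
    rw [NonlocalHeat.posPow, max_eq_left hs.le] at h
    exact nonneg_of_mul_nonneg_left h (Real.rpow_pos_of_pos hs _)
  have hC0 : 0 < C₂ := pos_of_mul_pos_left (hA0.trans_lt hA) (Real.rpow_nonneg hE0.le _)
  have hu0 := hu.initial
  obtain ⟨hAC, hd⟩ := hu.energy_deriv_le hT hC₂ hf
  have before : ∀ t ∈ Icc 0 T, t < 1 / B →
      NonlocalHeat.energy (u t) ≤ NonlocalHeat.energy u₀ * (1 - B * t) ^ (1 / |γ|) := by
    intro t ht htB
    have hBt : B * t < 1 := by have := (lt_div_iff₀ hB0).1 htB; linarith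
    have := energy_le_of_deriv_le (E := fun t => NonlocalHeat.energy (u t)) ht.1 hγ hA0 hC0
      (by simpa only [hu0] using hE0) hB0 (by simpa only [hu0] using hB) hBt
      (hAC.mono (by rw [uIcc_of_le ht.1, uIcc_of_le hT.le]; exact Icc_subset_Icc_right ht.2))
      (by filter_upwards [hd] with x hx hxm using hx ⟨hxm.1, hxm.2.trans_le ht.2⟩)
    simpa only [hu0] using this
  have hα : 0 < 1 / |γ| := by have := abs_pos.2 hγ.ne; positivity
  have after : ∀ t ∈ Icc 0 T, 1 / B ≤ t → NonlocalHeat.energy (u t) ≤ 0 := by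
    intro t ht htB
    have hB1 : 0 < 1 / B := by positivity
    have hend : NonlocalHeat.energy (u (1 / B)) ≤ 0 := by
      have hc := hAC.continuousOn
      rw [uIcc_of_le hT.le] at hc
      have hc1 : ContinuousWithinAt (fun t => NonlocalHeat.energy (u t)) (Ioo 0 (1 / B)) (1 / B) :=
        (hc (1 / B) ⟨hB1.le, htB.trans ht.2⟩).mono fun x hx =>
          ⟨hx.1.le, hx.2.le.trans (htB.trans ht.2)⟩
      have hc2 : ContinuousWithinAt
          (fun t => NonlocalHeat.energy u₀ * (1 - B * t) ^ (1 / |γ|)) (Ioo 0 (1 / B)) (1 / B) :=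
        (continuous_const.mul (Continuous.rpow_const (by fun_prop)
          fun _ => Or.inr hα.le)).continuousWithinAt
      have hcl : 1 / B ∈ closure (Ioo 0 (1 / B)) := by
        rw [closure_Ioo hB1.ne]; exact right_mem_Icc.2 hB1.le
      have := ContinuousWithinAt.closure_le hcl hc1 hc2 fun x hx =>
        before x ⟨hx.1.le, hx.2.le.trans (htB.trans ht.2)⟩ hx.2
      simpa [mul_inv_cancel₀ hB0.ne', Real.zero_rpow, hγ.ne] using this
    refine (hAC.mono (c := 1 / B) (d := t) ?_).nonpos_of_deriv_le_mul_self htB (K := 0) hend ?_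
    · rw [uIcc_of_le htB, uIcc_of_le hT.le]; exact Icc_subset_Icc hB1.le ht.2
    filter_upwards [hd] with x hx hxm hxpos
    have hBx : 1 - B * x ≤ 0 := by have := (div_lt_iff₀ hB0).1 hxm.1; linarith
    refine (hx ⟨hB1.trans hxm.1, hxm.2.trans_le ht.2⟩).trans ?_
    rw [NonlocalHeat.posPow, max_eq_right hBx, zero_mul]
    have hp := Real.rpow_pos_of_pos hxpos γ
    have hpp := mul_pos hC0 (mul_pos hp hxpos)
    -- For `γ = -1/2` the convention `0^0 = 1` keeps the source alive after `1/B`; but then `E^(γ+1)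
    -- = √E` and `hA` reads `A < C₂`, so dissipation still wins. Otherwise the source vanishes.
    by_cases hr : 2 * γ + 1 = 0
    · have hγ' : γ = -(1 / 2) := by linarith
      have h1 : NonlocalHeat.energy (u x) ^ γ * NonlocalHeat.energy (u x)
          = √(NonlocalHeat.energy (u x)) := by
        rw [Real.sqrt_eq_rpow]
        nth_rewrite 2 [← Real.rpow_one (NonlocalHeat.energy (u x))]
        rw [← Real.rpow_add hxpos, hγ']; norm_num
      rw [h1, hr]
      rw [hr] at hA
      simp only [zero_div, Real.rpow_zero, neg_zero, mul_one] at hA ⊢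
      have := mul_le_mul_of_nonneg_right hA.le (Real.sqrt_nonneg (NonlocalHeat.energy (u x)))
      linarith
    · rw [Real.zero_rpow (neg_ne_zero.2 (div_ne_zero hr (by linarith)))]
      linarith
  refine ⟨fun t ht => ?_, hB0, fun t ht htB => ?_⟩
  · rcases lt_or_ge t (1 / B) with h | h
    · have hBt : 0 ≤ 1 - B * t := by have := (lt_div_iff₀ hB0).1 h; linarith
      rw [NonlocalHeat.posPow, max_eq_left hBt]
      exact before t ht h
    · refine (after t ht h).trans (mul_nonneg hE0.le (Real.rpow_nonneg (le_max_right _ _) _))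
  · have := after t ht htB
    rw [NonlocalHeat.energy_eq_norm_sq] at this
    exact norm_eq_zero.1 (pow_eq_zero_iff two_ne_zero |>.1 (le_antisymm this (by positivity)))
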